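/- **Theorem (existence for the convexified formulation of compliance minimization).** Let $N\ge 2$, let $D\subset\mathbb{R}^N$ be a bounded domain (nonempty, open, connected), and let $\Gamma_D,\Gamma_N\subset\partial D$ be disjoint, with $\Gamma_N$ Borel. Let $\mathcal M^s_N$ be the space of symmetric real $N\times N$ matrices with $\xi\cdot\eta=\sum_{i,j}\xi_{ij}\eta_{ij}$, and let $A:\mathcal M^s_N\to\mathcal M^s_N$ be a (constant) Hooke's law, i.e. a symmetric positive definite linear map; for example $A\xi=2\mu\xi+(\kappa-\tfrac{2\mu}{N})\operatorname{tr}(\xi)\,\mathrm{Id}$ with $\kappa,\mu>0$. Let $g:\Gamma_N\to\mathbb{R}^N$ be a surface load, integrable for the surface measure $ds$ (the normalized $(N-1)$-dimensional Hausdorff measure), and let $\ell\in\mathbb{R}$. Let $\Sigma_{\rm ad}$ be the set of statically admissible stresses, that is, of the fields $\tau\in L^2(D;\mathcal M^s_N)$ such that $$-\operatorname{div}\tau=0 \text{ in } D,\qquad \tau\cdot n=g \text{ on } \Gamma_N,\qquad \tau\cdot n=0\text{ on }\partial D\setminus(\Gamma_N\cup\Gamma_D),$$ where the equation is understood in the sense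 of distributions and the boundary conditions in the weak sense: $\int_D\tau\cdot e(\varphi)\,dx=\int_{\Gamma_N}g\cdot\varphi\,ds$, with $e(\varphi)=(\nabla\varphi+(\nabla\varphi)^t)/2$, for every $\varphi\in C^\infty(\mathbb{R}^N;\mathbb{R}^N)$ that vanishes on $\Gamma_D$. Assume that the load can be equilibrated, i.e. $\Sigma_{\rm ad}\neq\emptyset$. For $\theta\in L^\infty(D;[0,1])$ and $\tau\in\Sigma_{\rm ad}$ put $$J(\theta,\tau)=\int_D(\theta(x)A)^{-1}\tau\cdot\tau\,dx+\ell\int_D\theta(x)\,dx\in(-\infty,+\infty],$$ where, at points with $\theta(x)=0$, the integrand $(\theta(x)A)^{-1}\tau\cdot\tau$ is $0$ if $\tau(x)=0$ and $+\infty$ otherwise. Then the problem $$\min_{\theta\in L^\infty(D;[0,1])}\ \min_{\tau\in\Sigma_{\rm ad}}\ J(\theta,\tau)$$ admits at least one solution: for every $\theta\in L^\infty(D;[0,1])$ the minimum of $J(\theta,\cdot)$ over $\Sigma_{\rm ad}$ is attained (its value may be $+\infty$), and there are $\theta^*\in L^\infty(D;[0,1])$ and $\tau^*\in\Sigma_{\rm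 ad}$ with $J(\theta^*,\tau^*)<+\infty$ and $J(\theta^*,\tau^*)\le J(\theta,\tau)$ for all $\theta\in L^\infty(D;[0,1])$ and all $\tau\in\Sigma_{\rm ad}$. -/

import Mathlib

open MeasureTheory Set
open scoped ENNReal ContDiff

namespace SIMP

/-- The space of symmetric real matrices of order `N` (strain and stress tensors). -/
def SymMat (N : ℕ) : Submodule ℝ (Matrix (Fin N) (Fin N) ℝ) where
  carrier := {M | M.IsSymm}
  add_mem' := fun ha hb => Matrix.IsSymm.add ha hb
  zero_mem' := Matrix.isSymm_zero
  smul_mem' := fun c _ ha => Matrix.IsSymm.smul ha c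

/-- The full contraction `ξ · η = ∑ i j, ξ i j * η i j` of two symmetric matrices. -/
def contract {N : ℕ} (ξ η : SymMat N) : ℝ :=
  ∑ i, ∑ j, (ξ : Matrix (Fin N) (Fin N) ℝ) i j * (η : Matrix (Fin N) (Fin N) ℝ) i j

/-- A Hooke's law: a symmetric, positive definite linear map `A` on symmetric matrices.
Positive definiteness makes such a map bijective, so its inverse is `A.toEquiv.symm`. -/
structure HookeLaw (N : ℕ) where
  toEquiv : SymMat N ≃ₗ[ℝ] SymMat N
  symmetric : ∀ ξ η : SymMat N, contract (toEquiv ξ) η = contract ξ (toEquiv η)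
  posDef : ∀ ξ : SymMat N, ξ ≠ 0 → 0 < contract (toEquiv ξ) ξ

/-- The symmetric matrix `a • ξ + b • tr(ξ) • Id`. -/
def isoMap (N : ℕ) (a b : ℝ) : SymMat N →ₗ[ℝ] SymMat N where
  toFun ξ := ⟨a • (ξ : Matrix (Fin N) (Fin N) ℝ)
      + (b * (ξ : Matrix (Fin N) (Fin N) ℝ).trace) • (1 : Matrix (Fin N) (Fin N) ℝ),
    Matrix.IsSymm.add (Matrix.IsSymm.smul ξ.2 a) (Matrix.IsSymm.smul Matrix.isSymm_one _)⟩
  map_add' ξ η := by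
    apply Subtype.ext
    simp [Matrix.trace_add, mul_add, add_smul]
    abel
  map_smul' c ξ := by
    apply Subtype.ext
    simp only [SetLike.val_smul, Matrix.trace_smul, smul_eq_mul, RingHom.id_apply, smul_add,
      smul_smul]
    congr 2 <;> ring

theorem isoMap_comp {N : ℕ} {a b a' b' : ℝ} (h1 : a' * a = 1)
    (h2 : a' * b + b' * (a + b * N) = 0) (ξ : SymMat N) :
    isoMap N a' b' (isoMap N a b ξ) = ξ := by
  apply Subtype.ext
  ext i j
  simp only [isoMap, LinearMap.coe_mk, AddHom.coe_mk, Matrix.trace_add, Matrix.trace_smul,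
    Matrix.trace_one, Fintype.card_fin, Matrix.add_apply, Matrix.smul_apply, smul_eq_mul]
  linear_combination (ξ : Matrix (Fin N) (Fin N) ℝ) i j * h1
    + (ξ : Matrix (Fin N) (Fin N) ℝ).trace * (1 : Matrix (Fin N) (Fin N) ℝ) i j * h2

theorem contract_isoMap {N : ℕ} (a b : ℝ) (ξ η : SymMat N) :
    contract (isoMap N a b ξ) η = a * contract ξ η
      + b * ((ξ : Matrix (Fin N) (Fin N) ℝ).trace * (η : Matrix (Fin N) (Fin N) ℝ).trace) := by
  simp only [contract, isoMap, LinearMap.coe_mk, AddHom.coe_mk, Matrix.add_apply,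
    Matrix.smul_apply, smul_eq_mul, add_mul, Finset.sum_add_distrib, Finset.mul_sum, Matrix.trace,
    Matrix.diag]
  congr 1
  · simp [mul_assoc]
  · simp [Matrix.one_apply, ← Finset.mul_sum, mul_assoc]

theorem contract_comm {N : ℕ} (ξ η : SymMat N) : contract ξ η = contract η ξ := by
  simp [contract, mul_comm]

theorem trace_sq_le {N : ℕ} (ξ : SymMat N) :
    (ξ : Matrix (Fin N) (Fin N) ℝ).trace ^ 2 ≤ N * contract ξ ξ := by
  have h := sq_sum_le_card_mul_sum_sq (s := Finset.univ)
    (f := fun i : Fin N => (ξ : Matrix (Fin N) (Fin N) ℝ) i i)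
  simp only [Finset.card_univ, Fintype.card_fin] at h
  refine h.trans (mul_le_mul_of_nonneg_left ?_ (Nat.cast_nonneg _))
  refine Finset.sum_le_sum fun i _ => ?_
  have := Finset.single_le_sum
    (f := fun j => (ξ : Matrix (Fin N) (Fin N) ℝ) i j * (ξ : Matrix (Fin N) (Fin N) ℝ) i j)
    (fun j _ => mul_self_nonneg _) (Finset.mem_univ i)
  simpa [sq] using this

theorem contract_self_pos {N : ℕ} {ξ : SymMat N} (h : ξ ≠ 0) : 0 < contract ξ ξ := by
  have h0 : 0 ≤ contract ξ ξ :=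
    Finset.sum_nonneg fun i _ => Finset.sum_nonneg fun j _ => mul_self_nonneg _
  refine lt_of_le_of_ne h0 fun he => h ?_
  apply Subtype.ext
  ext i j
  have h1 := (Finset.sum_eq_zero_iff_of_nonneg
    (fun i _ => Finset.sum_nonneg fun j _ => mul_self_nonneg _)).1 he.symm i (Finset.mem_univ i)
  have h2 := (Finset.sum_eq_zero_iff_of_nonneg
    (fun j _ => mul_self_nonneg _)).1 h1 j (Finset.mem_univ j)
  simpa using h2

/-- The isotropic Hooke's law with positive bulk and shear moduli `κ` and `μ`:
`A ξ = 2 μ ξ + (κ - 2 μ / N) tr(ξ) Id`. -/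
noncomputable def isotropicHooke (N : ℕ) (hN : 0 < N) (κ μ : ℝ) (hκ : 0 < κ) (hμ : 0 < μ) :
    HookeLaw N where
  toEquiv := LinearEquiv.ofLinearMap (isoMap N (2 * μ) (κ - 2 * μ / N))
    (isoMap N (1 / (2 * μ)) (1 / N * (1 / (N * κ) - 1 / (2 * μ))))
    (by
      have hN' : (N : ℝ) ≠ 0 := by positivity
      ext1 ξ
      exact isoMap_comp (by field_simp) (by field_simp; ring) ξ)
    (by
      have hN' : (N : ℝ) ≠ 0 := by positivity
      ext1 ξ
      exact isoMap_comp (by field_simp) (by field_simp; ring) ξ)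
  symmetric ξ η := by
    simp only [LinearEquiv.coe_ofLinearMap]
    rw [contract_comm ξ, contract_isoMap, contract_isoMap, contract_comm ξ, mul_comm (Matrix.trace _)]
  posDef ξ hξ := by
    simp only [LinearEquiv.coe_ofLinearMap]
    rw [contract_isoMap]
    have hN' : (0 : ℝ) < N := by exact_mod_cast hN
    have h1 := trace_sq_le ξ
    have h2 := contract_self_pos hξ
    set t := (ξ : Matrix (Fin N) (Fin N) ℝ).trace
    set s := contract ξ ξ
    have h3 : t ^ 2 / N ≤ s := by rw [div_le_iff₀ hN']; linarith
    have e : 2 * μ * s + (κ - 2 * μ / N) * (t * t) = 2 * μ * (s - t ^ 2 / N) + κ * t ^ 2 := by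
      ring
    rw [e]
    rcases eq_or_ne t 0 with ht | ht
    · rw [ht]; simp; positivity
    · have : 0 ≤ 2 * μ * (s - t ^ 2 / N) := mul_nonneg (by positivity) (by linarith)
      positivity

/-- The complementary energy density `(a A)⁻¹ σ · σ = a⁻¹ (A⁻¹ σ · σ)` of the material `a A`,
with values in `[0, ∞]`.  By the conventions of `ℝ≥0∞` it is `0` for `a = 0`, `σ = 0` and `∞` for
`a = 0`, `σ ≠ 0`: the void bears no stress. -/
noncomputable def energyDensity {N : ℕ} (A : HookeLaw N) (a : ℝ) (σ : SymMat N) : ℝ≥0∞ :=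
  (ENNReal.ofReal a)⁻¹ * ENNReal.ofReal (contract (A.toEquiv.symm σ) σ)

theorem energyDensity_of_pos {N : ℕ} (A : HookeLaw N) {a : ℝ} (ha : 0 < a) {σ ξ : SymMat N}
    (h : a • A.toEquiv ξ = σ) : energyDensity A a σ = ENNReal.ofReal (contract ξ σ) := by
  have e : A.toEquiv.symm σ = a • ξ := by rw [← h, map_smul, LinearEquiv.symm_apply_apply]
  have c : contract (a • ξ) σ = a * contract ξ σ := by
    simp [contract, Finset.mul_sum, mul_assoc]
  rw [energyDensity, e, c, ENNReal.ofReal_mul ha.le, ← mul_assoc,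
    ENNReal.inv_mul_cancel (by simpa using ha) ENNReal.ofReal_ne_top, one_mul]

/-- The strain `e(φ) = (∇φ + (∇φ)ᵗ) / 2` of a vector field `φ` at the point `x`. -/
noncomputable def strain {N : ℕ} (φ : EuclideanSpace ℝ (Fin N) → EuclideanSpace ℝ (Fin N))
    (x : EuclideanSpace ℝ (Fin N)) : SymMat N :=
  ⟨Matrix.of fun i j => (fderiv ℝ φ x (EuclideanSpace.single j 1) i
      + fderiv ℝ φ x (EuclideanSpace.single i 1) j) / 2, by
    refine Matrix.IsSymm.ext fun i j => ?_
    simp [add_comm]⟩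

/-- The admissible densities `L^∞(D; [0, 1])`. -/
def densities {N : ℕ} (D : Set (EuclideanSpace ℝ (Fin N))) :
    Set (EuclideanSpace ℝ (Fin N) → ℝ) :=
  {θ | MemLp θ ∞ (volume.restrict D) ∧ ∀ᵐ x ∂(volume.restrict D), θ x ∈ Icc (0 : ℝ) 1}

/-- `τ` is a statically admissible stress field: `τ` is a square integrable field of symmetric
matrices on `D` with `-div τ = 0` in `D`, `τ · n = g` on `ΓN` and `τ · n = 0` on
`∂D \ (ΓN ∪ ΓD)`.  The differential equation is understood in the sense of distributions and the
boundary conditions in the weak sense, through Green's formula (the principle of virtual work),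
tested with the smooth vector fields that vanish on `ΓD`.  The surface measure is the
`(N - 1)`-dimensional Hausdorff measure, normalized as surface area. -/
structure IsAdmissibleStress {N : ℕ} (D ΓD ΓN : Set (EuclideanSpace ℝ (Fin N)))
    (g : EuclideanSpace ℝ (Fin N) → EuclideanSpace ℝ (Fin N))
    (τ : EuclideanSpace ℝ (Fin N) → SymMat N) : Prop where
  memLp : ∀ i j, MemLp (fun x => (τ x : Matrix (Fin N) (Fin N) ℝ) i j) 2 (volume.restrict D)
  div_eq_zero : ∀ φ : EuclideanSpace ℝ (Fin N) → EuclideanSpace ℝ (Fin N),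
    ContDiff ℝ ∞ φ → HasCompactSupport φ → tsupport φ ⊆ D →
      ∫ x in D, contract (τ x) (strain φ x) = 0
  traction : ∀ φ : EuclideanSpace ℝ (Fin N) → EuclideanSpace ℝ (Fin N),
    ContDiff ℝ ∞ φ → (∀ x ∈ ΓD, φ x = 0) →
      ∫ x in D, contract (τ x) (strain φ x)
        = ∫ x in ΓN, inner ℝ (g x) (φ x) ∂(μHE[N - 1] : Measure (EuclideanSpace ℝ (Fin N)))

/-- The set of statically admissible stress fields. -/
def admissibleStresses {N : ℕ} (D ΓD ΓN : Set (EuclideanSpace ℝ (Fin N)))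
    (g : EuclideanSpace ℝ (Fin N) → EuclideanSpace ℝ (Fin N)) :
    Set (EuclideanSpace ℝ (Fin N) → SymMat N) :=
  {τ | IsAdmissibleStress D ΓD ΓN g τ}

/-- The objective `∫_D (θ A)⁻¹ τ · τ dx + ℓ ∫_D θ dx`, with values in `(-∞, ∞]`. -/
noncomputable def objective {N : ℕ} (A : HookeLaw N) (D : Set (EuclideanSpace ℝ (Fin N))) (ℓ : ℝ)
    (θ : EuclideanSpace ℝ (Fin N) → ℝ) (τ : EuclideanSpace ℝ (Fin N) → SymMat N) : EReal :=
  ((∫⁻ x in D, energyDensity A (θ x) (τ x) : ℝ≥0∞) : EReal) + ((ℓ * ∫ x in D, θ x : ℝ) : EReal)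

end SIMP

/-! The energy density `(a, σ) ↦ a⁻¹ (A⁻¹ σ · σ)` is the perspective of a positive definite
quadratic form: it is positively homogeneous of degree one (`energyDensity_smul`) and subadditive
for `a ≥ 0` (`energyDensity_add_le`), hence jointly convex. With the values `0` and `∞` at `a = 0`
it is also lower semicontinuous. The problem is therefore convex in the pair `(θ, τ)`, and the
direct method applies without relaxation.

A pair is treated as a single element of a Hilbert space `L²(D)`. Adding the constant `|ℓ|` to the
integrand makes it nonnegative, and the value `⊤` outside `[0, 1]` encodes the constraint on `θ`.
Since `θ ≤ 1`, the energy dominates `A⁻¹ τ · τ`, so sublevel sets are bounded; they are closed by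
Fatou's lemma and convex by convexity of the integrand. Admissibility of `τ` is a family of
continuous affine equations, so it cuts out a closed convex set. Weak compactness enters only
through the intersection property of nested closed bounded convex sets.

For fixed `θ` the same argument runs on the closed affine slice of pairs with that density. In the
joint problem, `θ = 1` provides a pair of finite energy. -/

/-! ### The direct method in a Hilbert space. -/

/-- In a Hilbert space, a decreasing sequence of nonempty, closed, convex sets, the first of which
is bounded, has a common point. -/
theorem exists_forall_mem_of_antitone_of_convex {H : Type*} [NormedAddCommGroup H]
    [InnerProductSpace ℝ H] [CompleteSpace H] {K : ℕ → Set H} (hanti : Antitone K)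
    (hne : ∀ n, (K n).Nonempty) (hclosed : ∀ n, IsClosed (K n)) (hconv : ∀ n, Convex ℝ (K n))
    (hbdd : Bornology.IsBounded (K 0)) : ∃ x, ∀ n, x ∈ K n := by
  -- The common point will be the limit of the elements of least norm, the projections of `0`.
  have hmin : ∀ n, ∃ x ∈ K n, ∀ y ∈ K n, ‖x‖ ≤ ‖y‖ := by
    intro n
    obtain ⟨x, hx, h⟩ := exists_norm_eq_iInf_of_complete_convex (hne n) (hclosed n).isComplete
      (hconv n) 0
    refine ⟨x, hx, fun y hy => ?_⟩
    have hle : (⨅ w : K n, ‖(0 : H) - w‖) ≤ ‖(0 : H) - (⟨y, hy⟩ : K n)‖ :=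
      ciInf_le ⟨0, by rintro _ ⟨w, rfl⟩; exact norm_nonneg _⟩ _
    rw [← h] at hle
    simpa using hle
  choose x hxK hxmin using hmin
  obtain ⟨R, hR⟩ := hbdd.exists_norm_le
  have hmono : Monotone fun n => ‖x n‖ ^ 2 := fun m n hmn =>
    pow_le_pow_left₀ (norm_nonneg _) (hxmin m _ (hanti hmn (hxK n))) 2
  have hbound : BddAbove (range fun n => ‖x n‖ ^ 2) :=
    ⟨R ^ 2, by
      rintro _ ⟨n, rfl⟩
      exact pow_le_pow_left₀ (norm_nonneg _) (hR _ (hanti (Nat.zero_le n) (hxK n))) 2⟩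
  -- The midpoint of `x n` and `x m` lies in `K m`, so its norm is at least `‖x m‖`; the
  -- parallelogram law turns this into a bound on the distance. As the norms increase to a finite
  -- limit, the sequence is Cauchy.
  have hdist : ∀ m n, m ≤ n → ‖x n - x m‖ ^ 2 ≤ 2 * (‖x n‖ ^ 2 - ‖x m‖ ^ 2) := by
    intro m n hmn
    have hmid : (1 / 2 : ℝ) • x n + (1 / 2 : ℝ) • x m ∈ K m :=
      hconv m (hanti hmn (hxK n)) (hxK m) (by norm_num) (by norm_num) (by norm_num)
    have h1 := hxmin m _ hmid
    rw [← smul_add, norm_smul] at h1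
    have h2 : 2 * ‖x m‖ ≤ ‖x n + x m‖ := by norm_num at h1; linarith
    have h3 := parallelogram_law_with_norm ℝ (x n) (x m)
    nlinarith [norm_nonneg (x m)]
  have hlim := tendsto_atTop_ciSup hmono hbound
  have hcauchy : CauchySeq x := by
    rw [Metric.cauchySeq_iff']
    intro ε hε
    obtain ⟨m, hm⟩ := (hlim.eventually
      (lt_mem_nhds (sub_lt_self _ (by positivity : (0 : ℝ) < ε ^ 2 / 2)))).exists
    refine ⟨m, fun n hn => ?_⟩
    have h1 := le_ciSup hbound n
    have h2 := hdist m n hn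
    rw [dist_eq_norm]
    refine lt_of_pow_lt_pow_left₀ 2 hε.le ?_
    have h1' : ‖x n‖ ^ 2 ≤ ⨆ n, ‖x n‖ ^ 2 := h1
    linarith
  obtain ⟨y, hy⟩ := cauchySeq_tendsto_of_complete hcauchy
  refine ⟨y, fun n => (hclosed n).mem_of_tendsto hy ?_⟩
  filter_upwards [Filter.eventually_ge_atTop n] with k hk using hanti hk (hxK k)

/-- The direct method: a function with closed, convex, bounded sublevel sets on a Hilbert space
attains its minimum as soon as it is finite somewhere. -/
theorem exists_forall_le_of_sublevel {H : Type*} [NormedAddCommGroup H]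
    [InnerProductSpace ℝ H] [CompleteSpace H] {K : Set H} {Φ : H → ℝ≥0∞}
    (hclosed : ∀ c, c ≠ ⊤ → IsClosed {x ∈ K | Φ x ≤ c})
    (hconv : ∀ c, c ≠ ⊤ → Convex ℝ {x ∈ K | Φ x ≤ c})
    (hbdd : ∀ c, c ≠ ⊤ → Bornology.IsBounded {x ∈ K | Φ x ≤ c})
    (hfin : ∃ x ∈ K, Φ x ≠ ⊤) : ∃ x ∈ K, ∀ y ∈ K, Φ x ≤ Φ y := by
  obtain ⟨x₀, hx₀, hΦ₀⟩ := hfin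
  set m := ⨅ x ∈ K, Φ x with hm
  have hmtop : m ≠ ⊤ := ne_top_of_le_ne_top hΦ₀ (iInf₂_le x₀ hx₀)
  -- Levels strictly above the infimum keep every sublevel set nonempty, and levels below `⊤` keep
  -- it bounded.
  obtain ⟨u, hu_anti, hu_lt, hu_lim⟩ := exists_seq_strictAnti_tendsto' hmtop.lt_top
  have hu_top : ∀ n, u n ≠ ⊤ := fun n => (hu_lt n).2.ne
  obtain ⟨x, hx⟩ := exists_forall_mem_of_antitone_of_convex
    (K := fun n => {x ∈ K | Φ x ≤ u n})
    (fun i j hij y hy => ⟨hy.1, hy.2.trans (hu_anti.antitone hij)⟩)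
    (fun n => by
      have h := (hu_lt n).1
      rw [hm] at h
      simp only [iInf_lt_iff] at h
      obtain ⟨y, hy, h⟩ := h
      exact ⟨y, hy, h.le⟩)
    (fun n => hclosed _ (hu_top n)) (fun n => hconv _ (hu_top n)) (hbdd _ (hu_top 0))
  refine ⟨x, (hx 0).1, fun y hy => ?_⟩
  exact (ge_of_tendsto' hu_lim fun n => (hx n).2).trans (iInf₂_le y hy)

/-! ### Integral functionals on `L²`. -/

section Integrand

variable {α V : Type*} [MeasurableSpace α] {μ : Measure α} [NormedAddCommGroup V]
  [MeasurableSpace V] [BorelSpace V] {F : V → ℝ≥0∞}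

/-- A convergent sequence in `L²` has an a.e. convergent subsequence, to which pointwise lower
semicontinuity and Fatou's lemma apply. -/
theorem isClosed_setOf_lintegral_comp_le (hF : LowerSemicontinuous F) (c : ℝ≥0∞) :
    IsClosed {f : Lp V 2 μ | ∫⁻ x, F (f x) ∂μ ≤ c} := by
  refine isSeqClosed_iff_isClosed.1 fun f g hf hfg => ?_
  obtain ⟨ns, -, hns⟩ := (tendstoInMeasure_of_tendsto_Lp hfg).exists_seq_tendsto_ae
  calc ∫⁻ x, F (g x) ∂μ
      ≤ ∫⁻ x, Filter.liminf (fun n => F (f (ns n) x)) Filter.atTop ∂μ := by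
        refine lintegral_mono_ae ?_
        filter_upwards [hns] with x hx
        refine le_of_forall_lt fun y hy => ?_
        obtain ⟨z, hyz, hz⟩ := exists_between hy
        exact hyz.trans_le (Filter.le_liminf_of_le (by isBoundedDefault)
          ((hx.eventually (hF _ z hz)).mono fun n hn => hn.le))
    _ ≤ Filter.liminf (fun n => ∫⁻ x, F (f (ns n) x) ∂μ) Filter.atTop :=
        lintegral_liminf_le' fun n =>
          hF.measurable.comp_aemeasurable (Lp.aestronglyMeasurable _).aemeasurable
    _ ≤ c := (Filter.liminf_le_liminf (Filter.Eventually.of_forall fun n => hf (ns n))).trans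
        (Filter.liminf_const c).le

variable [InnerProductSpace ℝ V]

theorem convex_setOf_lintegral_comp_le (hF : Measurable F)
    (hconv : ∀ v w : V, ∀ s t : ℝ, 0 ≤ s → 0 ≤ t → s + t = 1 →
      F (s • v + t • w) ≤ ENNReal.ofReal s * F v + ENNReal.ofReal t * F w) (c : ℝ≥0∞) :
    Convex ℝ {f : Lp V 2 μ | ∫⁻ x, F (f x) ∂μ ≤ c} := by
  intro f hf g hg s t hs ht hst
  have hmeas : ∀ h : Lp V 2 μ, AEMeasurable (fun x => F (h x)) μ := fun h =>
    hF.comp_aemeasurable (Lp.aestronglyMeasurable _).aemeasurable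
  calc ∫⁻ x, F ((s • f + t • g : Lp V 2 μ) x) ∂μ
      ≤ ∫⁻ x, (ENNReal.ofReal s * F (f x) + ENNReal.ofReal t * F (g x)) ∂μ := by
        refine lintegral_mono_ae ?_
        filter_upwards [Lp.coeFn_add (s • f) (t • g), Lp.coeFn_smul s f, Lp.coeFn_smul t g]
          with x h1 h2 h3
        rw [h1, Pi.add_apply, h2, h3]
        exact hconv _ _ s t hs ht hst
    _ = ENNReal.ofReal s * ∫⁻ x, F (f x) ∂μ + ENNReal.ofReal t * ∫⁻ x, F (g x) ∂μ := by
        rw [lintegral_add_left' ((hmeas f).const_mul _), lintegral_const_mul'' _ (hmeas f),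
          lintegral_const_mul'' _ (hmeas g)]
    _ ≤ ENNReal.ofReal s * c + ENNReal.ofReal t * c :=
        add_le_add (mul_le_mul_right hf _) (mul_le_mul_right hg _)
    _ = c := by rw [← add_mul, ← ENNReal.ofReal_add hs ht, hst, ENNReal.ofReal_one, one_mul]

theorem isBounded_setOf_lintegral_comp_le [IsFiniteMeasure μ] (hF : Measurable F) {C : ℝ≥0∞}
    (hC : C ≠ ⊤) (hcoer : ∀ v, ENNReal.ofReal (‖v‖ ^ 2) ≤ C * (1 + F v)) {c : ℝ≥0∞}
    (hc : c ≠ ⊤) : Bornology.IsBounded {f : Lp V 2 μ | ∫⁻ x, F (f x) ∂μ ≤ c} := by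
  set R := C * (μ univ + c)
  have hR : R ≠ ⊤ := ENNReal.mul_ne_top hC (ENNReal.add_ne_top.2 ⟨measure_ne_top _ _, hc⟩)
  -- The radius `1 + R` avoids a square root: `‖f‖ ^ 2 ≤ R` implies `‖f‖ ≤ 1 + R`.
  refine (Metric.isBounded_closedBall (x := (0 : Lp V 2 μ)) (r := 1 + R.toReal)).subset
    fun f hf => ?_
  have hmeas : AEMeasurable (fun x => F (f x)) μ :=
    hF.comp_aemeasurable (Lp.aestronglyMeasurable _).aemeasurable
  have h1 : ∫⁻ x, ENNReal.ofReal (‖f x‖ ^ 2) ∂μ ≤ R :=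
    calc ∫⁻ x, ENNReal.ofReal (‖f x‖ ^ 2) ∂μ ≤ ∫⁻ x, C * (1 + F (f x)) ∂μ :=
          lintegral_mono fun x => hcoer _
      _ = C * (μ univ + ∫⁻ x, F (f x) ∂μ) := by
          rw [lintegral_const_mul' _ _ hC, lintegral_add_left measurable_const, lintegral_const,
            one_mul]
      _ ≤ R := mul_le_mul_right (add_le_add le_rfl hf) _
  have h2 : ‖f‖ ^ 2 = ∫ x, ‖f x‖ ^ 2 ∂μ := by
    rw [← real_inner_self_eq_norm_sq, L2.inner_def]
    simp
  have h3 : ‖f‖ ^ 2 ≤ R.toReal := by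
    rw [h2, integral_eq_lintegral_of_nonneg_ae (f := fun x => ‖f x‖ ^ 2)
      (Filter.Eventually.of_forall fun x => sq_nonneg _) ((Lp.aestronglyMeasurable f).norm.pow 2)]
    exact ENNReal.toReal_mono hR h1
  rw [mem_closedBall_zero_iff]
  nlinarith [sq_nonneg (‖f‖ - 1), norm_nonneg f]

/-- Existence of minimizers of integral functionals with a lower semicontinuous, convex, coercive
integrand over closed convex sets of square integrable functions. -/
theorem exists_isMinOn_lintegral_comp [CompleteSpace V] [IsFiniteMeasure μ]
    (hF : LowerSemicontinuous F)
    (hconv : ∀ v w : V, ∀ s t : ℝ, 0 ≤ s → 0 ≤ t → s + t = 1 →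
      F (s • v + t • w) ≤ ENNReal.ofReal s * F v + ENNReal.ofReal t * F w)
    {C : ℝ≥0∞} (hC : C ≠ ⊤) (hcoer : ∀ v, ENNReal.ofReal (‖v‖ ^ 2) ≤ C * (1 + F v))
    {K : Set (Lp V 2 μ)} (hKclosed : IsClosed K) (hKconv : Convex ℝ K)
    (hfin : ∃ f ∈ K, ∫⁻ x, F (f x) ∂μ ≠ ⊤) :
    ∃ f ∈ K, ∀ g ∈ K, ∫⁻ x, F (f x) ∂μ ≤ ∫⁻ x, F (g x) ∂μ :=
  exists_forall_le_of_sublevel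
    (fun c _ => hKclosed.inter (isClosed_setOf_lintegral_comp_le hF c))
    (fun c _ => hKconv.inter (convex_setOf_lintegral_comp_le hF.measurable hconv c))
    (fun _ hc => (isBounded_setOf_lintegral_comp_le hF.measurable hC hcoer hc).subset
      inter_subset_right) hfin

end Integrand

/-! ### Joint convexity and semicontinuity of the energy density. -/

namespace SIMP

variable {N : ℕ}

/-- The contraction as a bilinear form. -/
def contractForm (N : ℕ) : SymMat N →ₗ[ℝ] SymMat N →ₗ[ℝ] ℝ :=
  LinearMap.mk₂ ℝ contract
    (fun _ _ _ => by simp [contract, add_mul, Finset.sum_add_distrib])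
    (fun _ _ _ => by simp [contract, mul_assoc, Finset.mul_sum])
    (fun _ _ _ => by simp [contract, mul_add, Finset.sum_add_distrib])
    (fun _ _ _ => by simp [contract, mul_left_comm, Finset.mul_sum])

@[simp]
theorem contractForm_apply (ξ η : SymMat N) : contractForm N ξ η = contract ξ η := rfl

namespace HookeLaw

variable (A : HookeLaw N)

/-- The bilinear form `(σ, η) ↦ A⁻¹ σ · η`. -/
def compliance : SymMat N →ₗ[ℝ] SymMat N →ₗ[ℝ] ℝ :=
  contractForm N ∘ₗ A.toEquiv.symm.toLinearMap

theorem compliance_apply (σ η : SymMat N) :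
    A.compliance σ η = contract (A.toEquiv.symm σ) η := rfl

theorem compliance_comm (σ η : SymMat N) : A.compliance σ η = A.compliance η σ := by
  have h := A.symmetric (A.toEquiv.symm σ) (A.toEquiv.symm η)
  simp only [LinearEquiv.apply_symm_apply] at h
  rw [compliance_apply, compliance_apply, ← h, contract_comm]

theorem compliance_self_pos {σ : SymMat N} (h : σ ≠ 0) : 0 < A.compliance σ σ := by
  have := A.posDef (A.toEquiv.symm σ) (by simpa using h)
  rwa [LinearEquiv.apply_symm_apply, contract_comm] at this

theorem compliance_self_nonneg (σ : SymMat N) : 0 ≤ A.compliance σ σ := by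
  rcases eq_or_ne σ 0 with rfl | h
  · simp
  · exact (A.compliance_self_pos h).le

theorem continuous_compliance_self : Continuous fun σ : SymMat N => A.compliance σ σ := by
  have h : Continuous A.toEquiv.symm := A.toEquiv.symm.toLinearMap.continuous_of_finiteDimensional
  have hentry : ∀ i j, Continuous fun σ : SymMat N => (σ : Matrix (Fin N) (Fin N) ℝ) i j :=
    fun i j => continuous_subtype_val.matrix_elem i j
  simp only [compliance_apply, contract]
  exact continuous_finsetSum _ fun i _ => continuous_finsetSum _ fun j _ =>
    ((hentry i j).comp h).mul (hentry i j)

end HookeLaw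

variable (A : HookeLaw N)

theorem energyDensity_eq (a : ℝ) (σ : SymMat N) :
    energyDensity A a σ = (ENNReal.ofReal a)⁻¹ * ENNReal.ofReal (A.compliance σ σ) := rfl

@[simp]
theorem energyDensity_zero_right (a : ℝ) : energyDensity A a 0 = 0 := by
  simp [energyDensity_eq]

theorem energyDensity_zero_left {σ : SymMat N} (h : σ ≠ 0) : energyDensity A 0 σ = ⊤ := by
  simp [energyDensity_eq, ENNReal.top_mul, A.compliance_self_pos h]

theorem energyDensity_eq_ofReal_div {a : ℝ} (ha : 0 < a) (σ : SymMat N) :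
    energyDensity A a σ = ENNReal.ofReal (A.compliance σ σ / a) := by
  rw [energyDensity_eq, ENNReal.ofReal_div_of_pos ha, div_eq_mul_inv, mul_comm]

theorem energyDensity_smul {t : ℝ} (ht : 0 ≤ t) (a : ℝ) (σ : SymMat N) :
    energyDensity A (t * a) (t • σ) = ENNReal.ofReal t * energyDensity A a σ := by
  rcases ht.eq_or_lt with rfl | ht
  · simp
  have ht0 : ENNReal.ofReal t ≠ 0 := by simpa using ht
  simp only [energyDensity_eq, map_smul, LinearMap.smul_apply, smul_eq_mul]
  rw [ENNReal.ofReal_mul ht.le, ENNReal.ofReal_mul ht.le, ENNReal.ofReal_mul ht.le,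
    ENNReal.mul_inv (Or.inl ht0) (Or.inl ENNReal.ofReal_ne_top)]
  calc _ = ((ENNReal.ofReal t)⁻¹ * ENNReal.ofReal t) * (ENNReal.ofReal t *
        ((ENNReal.ofReal a)⁻¹ * ENNReal.ofReal (A.compliance σ σ))) := by ring
    _ = _ := by rw [ENNReal.inv_mul_cancel ht0 ENNReal.ofReal_ne_top, one_mul]

/-- For `a, b > 0`, clearing denominators reduces the inequality to nonnegativity of the compliance
form at `b • σ - a • η`. If a density vanishes, either its stress vanishes too or the right-hand
side is `⊤`. -/
theorem energyDensity_add_le {a b : ℝ} (ha : 0 ≤ a) (hb : 0 ≤ b) (σ η : SymMat N) :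
    energyDensity A (a + b) (σ + η) ≤ energyDensity A a σ + energyDensity A b η := by
  rcases ha.eq_or_lt with rfl | ha
  · rcases eq_or_ne σ 0 with rfl | hσ
    · simp
    · simp [energyDensity_zero_left A hσ]
  rcases hb.eq_or_lt with rfl | hb
  · rcases eq_or_ne η 0 with rfl | hη
    · simp
    · simp [energyDensity_zero_left A hη]
  have hab : 0 < a + b := add_pos ha hb
  rw [energyDensity_eq_ofReal_div A hab, energyDensity_eq_ofReal_div A ha,
    energyDensity_eq_ofReal_div A hb, ← ENNReal.ofReal_add
      (div_nonneg (A.compliance_self_nonneg σ) ha.le)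
      (div_nonneg (A.compliance_self_nonneg η) hb.le)]
  refine ENNReal.ofReal_le_ofReal ?_
  have h := A.compliance_self_nonneg (b • σ - a • η)
  simp only [map_sub, map_smul, LinearMap.sub_apply, LinearMap.smul_apply, smul_eq_mul,
    A.compliance_comm η σ] at h
  simp only [map_add, LinearMap.add_apply, A.compliance_comm η σ]
  rw [div_add_div _ _ ha.ne' hb.ne', div_le_div_iff₀ hab (by positivity)]
  linarith

theorem le_energyDensity {a : ℝ} (ha : a ≤ 1) (σ : SymMat N) :
    ENNReal.ofReal (A.compliance σ σ) ≤ energyDensity A a σ := by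
  rw [energyDensity_eq]
  exact le_mul_of_one_le_left zero_le (ENNReal.one_le_inv.2 (by simpa using ha))

/-- Multiplication on `ℝ≥0∞` is discontinuous only at `0 * ⊤`. Where the compliance factor is zero,
the product is `0` and there is nothing to prove; elsewhere the product is continuous. -/
theorem lowerSemicontinuous_energyDensity :
    LowerSemicontinuous fun p : ℝ × SymMat N => energyDensity A p.1 p.2 := by
  intro p
  simp only [energyDensity_eq]
  by_cases hp : ENNReal.ofReal (A.compliance p.2 p.2) = 0
  · intro y hy
    simp [hp] at hy
  · have h1 : Filter.Tendsto (fun q : ℝ × SymMat N => (ENNReal.ofReal q.1)⁻¹) (nhds p)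
        (nhds (ENNReal.ofReal p.1)⁻¹) :=
      (continuous_inv.comp (ENNReal.continuous_ofReal.comp continuous_fst)).tendsto p
    have h2 : Filter.Tendsto (fun q : ℝ × SymMat N => ENNReal.ofReal (A.compliance q.2 q.2))
        (nhds p) (nhds (ENNReal.ofReal (A.compliance p.2 p.2))) :=
      (ENNReal.continuous_ofReal.comp
        (A.continuous_compliance_self.comp continuous_snd)).tendsto p
    exact ContinuousAt.lowerSemicontinuousAt
      (ENNReal.Tendsto.mul h1 (Or.inr ENNReal.ofReal_ne_top) h2 (Or.inl hp))

/-! ### The shifted integrand carrying the density constraint. -/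

/-- The integrand of the objective, shifted by the constant `|ℓ|` so that it is nonnegative for
densities in `[0, 1]`, and extended by `⊤` to all other densities. -/
noncomputable def integrand (ℓ : ℝ) (p : ℝ × SymMat N) : ℝ≥0∞ :=
  energyDensity A p.1 p.2 + ENNReal.ofReal (ℓ * p.1 + |ℓ|)
    + (Icc (0 : ℝ) 1)ᶜ.indicator (fun _ => ⊤) p.1

variable (ℓ : ℝ)

theorem integrand_of_mem {p : ℝ × SymMat N} (hp : p.1 ∈ Icc (0 : ℝ) 1) :
    integrand A ℓ p = energyDensity A p.1 p.2 + ENNReal.ofReal (ℓ * p.1 + |ℓ|) := by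
  simp [integrand, indicator_of_notMem (notMem_compl_iff.2 hp)]

theorem integrand_of_notMem {p : ℝ × SymMat N} (hp : p.1 ∉ Icc (0 : ℝ) 1) :
    integrand A ℓ p = ⊤ := by
  simp [integrand, indicator_of_mem (mem_compl hp)]

theorem lowerSemicontinuous_integrand : LowerSemicontinuous (integrand A ℓ) := by
  refine ((lowerSemicontinuous_energyDensity A).add ?_).add ?_
  · exact Continuous.lowerSemicontinuous (ENNReal.continuous_ofReal.comp (by fun_prop))
  · exact (isClosed_Icc.isOpen_compl.lowerSemicontinuous_indicator zero_le).comp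
      continuous_fst

theorem integrand_convex (p q : ℝ × SymMat N) (s t : ℝ) (hs : 0 ≤ s) (ht : 0 ≤ t)
    (hst : s + t = 1) : integrand A ℓ (s • p + t • q)
      ≤ ENNReal.ofReal s * integrand A ℓ p + ENNReal.ofReal t * integrand A ℓ q := by
  -- Zero weights are set aside because `0 * ⊤ = 0`; with positive weights, a density outside `[0,
  -- 1]` makes the right-hand side `⊤`.
  rcases hs.eq_or_lt with rfl | hs'
  · obtain rfl : t = 1 := by linarith
    simp
  rcases ht.eq_or_lt with rfl | ht'
  · obtain rfl : s = 1 := by linarith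
    simp
  by_cases hp : p.1 ∈ Icc (0 : ℝ) 1
  swap
  · simp [integrand_of_notMem A ℓ hp, ENNReal.mul_top, hs']
  by_cases hq : q.1 ∈ Icc (0 : ℝ) 1
  swap
  · simp [integrand_of_notMem A ℓ hq, ENNReal.mul_top, ht']
  have hpq : (s • p + t • q).1 ∈ Icc (0 : ℝ) 1 := (convex_Icc (0 : ℝ) 1) hp hq hs ht hst
  have hpos : ∀ {a : ℝ}, a ∈ Icc (0 : ℝ) 1 → 0 ≤ ℓ * a + |ℓ| := by
    intro a ha
    nlinarith [neg_abs_le ℓ, abs_nonneg ℓ, ha.1, ha.2]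
  rw [integrand_of_mem A ℓ hp, integrand_of_mem A ℓ hq, integrand_of_mem A ℓ hpq, mul_add,
    mul_add, add_add_add_comm]
  refine add_le_add ?_ (le_of_eq ?_)
  · rw [← energyDensity_smul A hs, ← energyDensity_smul A ht]
    exact energyDensity_add_le A (mul_nonneg hs hp.1) (mul_nonneg ht hq.1) _ _
  · rw [← ENNReal.ofReal_mul hs, ← ENNReal.ofReal_mul ht, ← ENNReal.ofReal_add
      (mul_nonneg hs (hpos hp)) (mul_nonneg ht (hpos hq))]
    congr 1
    simp only [Prod.fst_add, Prod.smul_fst, smul_eq_mul]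
    linear_combination (-|ℓ|) * hst

theorem integrand_coercive {V : Type*} [NormedAddCommGroup V] [InnerProductSpace ℝ V]
    [FiniteDimensional ℝ V] (L : V ≃ₗ[ℝ] ℝ × SymMat N) :
    ∃ C : ℝ≥0∞, C ≠ ⊤ ∧ ∀ v, ENNReal.ofReal (‖v‖ ^ 2) ≤ C * (1 + integrand A ℓ (L v)) := by
  -- `Q` is a positive definite quadratic form, so its minimum on the unit sphere gives `m * ‖v‖ ^ 2
  -- ≤ Q v`. On admissible densities the first term of `Q` is at most `1`, and the second is at most
  -- the energy.
  set Q : V → ℝ := fun v => (L v).1 ^ 2 + A.compliance (L v).2 (L v).2 with hQ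
  have hL : Continuous L := L.toLinearMap.continuous_of_finiteDimensional
  have hQcont : Continuous Q :=
    ((continuous_fst.comp hL).pow 2).add
      (A.continuous_compliance_self.comp (continuous_snd.comp hL))
  have hQpos : ∀ v, v ≠ 0 → 0 < Q v := by
    intro v hv
    by_cases h : (L v).2 = 0
    · have h1 : (L v).1 ≠ 0 := fun h1 => hv (by
        have : L v = 0 := Prod.ext h1 h
        simpa using this)
      simp only [hQ, h, map_zero, add_zero]
      positivity
    · have := A.compliance_self_pos h
      simp only [hQ]
      positivity
  have hQsmul : ∀ (t : ℝ) v, Q (t • v) = t ^ 2 * Q v := by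
    intro t v
    simp [hQ]
    ring
  obtain ⟨m, hm, hmQ⟩ : ∃ m > 0, ∀ v : V, m * ‖v‖ ^ 2 ≤ Q v := by
    rcases subsingleton_or_nontrivial V with hV | hV
    · exact ⟨1, one_pos, fun v => by simp [Subsingleton.elim v 0, hQ]⟩
    obtain ⟨u, hu, hmin⟩ := (isCompact_sphere (0 : V) 1).exists_isMinOn
      (NormedSpace.sphere_nonempty.2 zero_le_one) hQcont.continuousOn
    refine ⟨Q u, hQpos u (ne_zero_of_mem_unit_sphere ⟨u, hu⟩), fun v => ?_⟩
    rcases eq_or_ne v 0 with rfl | hv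
    · simp [hQ]
    have hv' : ‖v‖ ≠ 0 := norm_ne_zero_iff.2 hv
    have h1 : Q u ≤ Q (‖v‖⁻¹ • v) := hmin (by simp [norm_smul, hv'])
    calc Q u * ‖v‖ ^ 2 ≤ Q (‖v‖⁻¹ • v) * ‖v‖ ^ 2 := by gcongr
      _ = Q v := by rw [hQsmul]; field_simp
  refine ⟨ENNReal.ofReal m⁻¹, ENNReal.ofReal_ne_top, fun v => ?_⟩
  by_cases hv : (L v).1 ∈ Icc (0 : ℝ) 1
  · have h1 : ‖v‖ ^ 2 ≤ m⁻¹ * (1 + A.compliance (L v).2 (L v).2) := by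
      rw [inv_mul_eq_div, le_div_iff₀ hm, mul_comm]
      refine (hmQ v).trans (add_le_add (pow_le_one₀ hv.1 hv.2) le_rfl)
    refine (ENNReal.ofReal_le_ofReal h1).trans ?_
    rw [ENNReal.ofReal_mul (by positivity), ENNReal.ofReal_add zero_le_one
      (A.compliance_self_nonneg _), ENNReal.ofReal_one, integrand_of_mem A ℓ hv]
    gcongr
    exact (le_energyDensity A hv.2 _).trans le_self_add
  · rw [integrand_of_notMem A ℓ hv, add_top, ENNReal.mul_top (by simpa using hm)]
    exact le_top

end SIMP

/-! ### Density-stress pairs in `L²` and static admissibility. -/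

namespace SIMP

variable {N : ℕ}

/-- A Euclidean space of the dimension of `ℝ × SymMat N`, the values of pairs of a density and a
stress field. -/
abbrev PairSpace (N : ℕ) : Type := EuclideanSpace ℝ (Fin (Module.finrank ℝ (ℝ × SymMat N)))

/-- A linear identification of `PairSpace N` with `ℝ × SymMat N`. -/
noncomputable def pairEquiv (N : ℕ) : PairSpace N ≃ₗ[ℝ] ℝ × SymMat N :=
  LinearEquiv.ofFinrankEq _ _ (by simp)

/-- The linear map representing `v ↦ (pairEquiv N v).2 · ξ` by the inner product. -/
noncomputable def contractRep (N : ℕ) : SymMat N →ₗ[ℝ] PairSpace N where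
  toFun ξ := (InnerProductSpace.toDual ℝ (PairSpace N)).symm
    (LinearMap.toContinuousLinearMap
      ((contractForm N).flip ξ ∘ₗ LinearMap.snd ℝ ℝ (SymMat N) ∘ₗ (pairEquiv N).toLinearMap))
  map_add' ξ η := by simp [LinearMap.add_comp]
  map_smul' c ξ := by simp [LinearMap.smul_comp]

theorem inner_contractRep (ξ : SymMat N) (v : PairSpace N) :
    inner ℝ (contractRep N ξ) v = contract (pairEquiv N v).2 ξ := by
  simp [contractRep]

theorem continuous_strain {φ : EuclideanSpace ℝ (Fin N) → EuclideanSpace ℝ (Fin N)}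
    (hφ : ContDiff ℝ ∞ φ) : Continuous (strain φ) := by
  have h : Continuous (fderiv ℝ φ) := hφ.continuous_fderiv (by simp)
  refine Continuous.subtype_mk (continuous_matrix fun i j => ?_) _
  simp only [Matrix.of_apply]
  fun_prop

theorem _root_.Continuous.memLp_restrict_of_isBounded {E : Type*} [NormedAddCommGroup E]
    [SecondCountableTopology E]
    {D : Set (EuclideanSpace ℝ (Fin N))} (hD : Bornology.IsBounded D) (p : ℝ≥0∞)
    {w : EuclideanSpace ℝ (Fin N) → E} (hw : Continuous w) : MemLp w p (volume.restrict D) := by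
  have : IsFiniteMeasure (volume.restrict D) :=
    isFiniteMeasure_restrict.2 hD.measure_lt_top.ne
  obtain ⟨C, hC⟩ := hD.isCompact_closure.exists_bound_of_continuousOn hw.continuousOn
  refine MemLp.mono_measure (Measure.restrict_mono subset_closure le_rfl) ?_
  have : IsFiniteMeasure (volume.restrict (closure D)) :=
    isFiniteMeasure_restrict.2 hD.closure.measure_lt_top.ne
  exact MemLp.of_bound hw.aestronglyMeasurable C
    ((ae_restrict_iff' isClosed_closure.measurableSet).2 (Filter.Eventually.of_forall hC))

variable {D ΓD ΓN : Set (EuclideanSpace ℝ (Fin N))}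
  {g : EuclideanSpace ℝ (Fin N) → EuclideanSpace ℝ (Fin N)}

/-- The virtual work of the stress in a smooth displacement is a continuous functional. -/
theorem exists_virtualWork (hD : Bornology.IsBounded D)
    {φ : EuclideanSpace ℝ (Fin N) → EuclideanSpace ℝ (Fin N)} (hφ : ContDiff ℝ ∞ φ) :
    ∃ w : Lp (PairSpace N) 2 (volume.restrict D) →L[ℝ] ℝ,
      ∀ f, w f = ∫ x in D, contract (pairEquiv N (f x)).2 (strain φ x) := by
  have hw : MemLp (fun x => contractRep N (strain φ x)) 2 (volume.restrict D) :=
    ((contractRep N).continuous_of_finiteDimensional.comp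
      (continuous_strain hφ)).memLp_restrict_of_isBounded hD 2
  refine ⟨innerSL ℝ (hw.toLp _), fun f => ?_⟩
  rw [innerSL_apply_apply, L2.inner_def]
  refine integral_congr_ae ?_
  filter_upwards [hw.coeFn_toLp] with x hx
  rw [hx, inner_contractRep]

theorem memLp_linearMap_comp {μ : Measure (EuclideanSpace ℝ (Fin N))}
    (f : Lp (PairSpace N) 2 μ) (l : PairSpace N →ₗ[ℝ] ℝ) : MemLp (fun x => l (f x)) 2 μ :=
  (LinearMap.toContinuousLinearMap l).comp_memLp' (Lp.memLp f)

/-- The entry `(i, j)` of a symmetric matrix, as a linear form. -/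
def entry (i j : Fin N) : SymMat N →ₗ[ℝ] ℝ where
  toFun ξ := (ξ : Matrix (Fin N) (Fin N) ℝ) i j
  map_add' _ _ := rfl
  map_smul' _ _ := rfl

theorem memLp_linearMap_stress {μ : Measure (EuclideanSpace ℝ (Fin N))}
    (f : Lp (PairSpace N) 2 μ) (l : SymMat N →ₗ[ℝ] ℝ) :
    MemLp (fun x => l (pairEquiv N (f x)).2) 2 μ :=
  memLp_linearMap_comp f (l ∘ₗ LinearMap.snd ℝ ℝ (SymMat N) ∘ₗ (pairEquiv N).toLinearMap)

/-- Test fields supported in the open set `D` vanish on its frontier, so the virtual work identity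
already contains the interior equation. Square integrability is automatic for `f` in `L²`. What
remains is a family of affine equations in `f`. -/
theorem isAdmissibleStress_iff (hD_open : IsOpen D) (hΓD : ΓD ⊆ frontier D)
    (hΓN : ΓN ⊆ frontier D) (hΓN_meas : MeasurableSet ΓN)
    (f : Lp (PairSpace N) 2 (volume.restrict D)) :
    IsAdmissibleStress D ΓD ΓN g (fun x => (pairEquiv N (f x)).2) ↔
      ∀ φ : EuclideanSpace ℝ (Fin N) → EuclideanSpace ℝ (Fin N),
        ContDiff ℝ ∞ φ → (∀ x ∈ ΓD, φ x = 0) →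
        ∫ x in D, contract (pairEquiv N (f x)).2 (strain φ x)
          = ∫ x in ΓN, inner ℝ (g x) (φ x)
              ∂(μHE[N - 1] : Measure (EuclideanSpace ℝ (Fin N))) := by
  refine ⟨fun h => h.traction, fun h => ⟨fun i j => ?_, fun φ hφ _ hsupp => ?_, h⟩⟩
  · exact memLp_linearMap_stress f (entry i j)
  · have h0 : ∀ x ∈ frontier D, φ x = 0 := fun x hx =>
      image_eq_zero_of_notMem_tsupport fun hx' => by
        rw [hD_open.frontier_eq] at hx
        exact hx.2 (hsupp hx')
    rw [h φ hφ fun x hx => h0 x (hΓD hx), setIntegral_congr_fun (g := fun _ => 0) hΓN_meas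
      fun x hx => by simp [h0 x (hΓN hx)]]
    simp

theorem IsAdmissibleStress.congr_ae {τ τ' : EuclideanSpace ℝ (Fin N) → SymMat N}
    (h : IsAdmissibleStress D ΓD ΓN g τ) (hττ' : τ =ᵐ[volume.restrict D] τ') :
    IsAdmissibleStress D ΓD ΓN g τ' := by
  have hint : ∀ φ, ∫ x in D, contract (τ' x) (strain φ x)
      = ∫ x in D, contract (τ x) (strain φ x) := fun φ =>
    integral_congr_ae (hττ'.mono fun x hx => by simp only [hx])
  refine ⟨fun i j => (memLp_congr_ae (hττ'.mono fun x hx => ?_)).1 (h.memLp i j),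
    fun φ h1 h2 h3 => ?_, fun φ h1 h2 => ?_⟩
  · simp only [hx]
  · rw [hint, h.div_eq_zero φ h1 h2 h3]
  · rw [hint, h.traction φ h1 h2]

variable (D ΓD ΓN g) in
/-- The pairs of a density and a stress in `L²` with a statically admissible stress. -/
def admissiblePairs : Set (Lp (PairSpace N) 2 (volume.restrict D)) :=
  {f | IsAdmissibleStress D ΓD ΓN g fun x => (pairEquiv N (f x)).2}

theorem isClosed_and_convex_admissiblePairs (hD_open : IsOpen D) (hD_bdd : Bornology.IsBounded D)
    (hΓD : ΓD ⊆ frontier D) (hΓN : ΓN ⊆ frontier D) (hΓN_meas : MeasurableSet ΓN) :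
    IsClosed (admissiblePairs D ΓD ΓN g) ∧ Convex ℝ (admissiblePairs D ΓD ΓN g) := by
  simp only [admissiblePairs, isAdmissibleStress_iff hD_open hΓD hΓN hΓN_meas, ofPred_forall]
  constructor
  · refine isClosed_iInter fun φ => isClosed_iInter fun hφ => isClosed_iInter fun _ => ?_
    obtain ⟨w, hw⟩ := exists_virtualWork hD_bdd hφ
    simp only [← hw]
    exact isClosed_eq w.continuous continuous_const
  · refine convex_iInter fun φ => convex_iInter fun hφ => convex_iInter fun _ => ?_
    obtain ⟨w, hw⟩ := exists_virtualWork hD_bdd hφ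
    simp only [← hw]
    exact convex_hyperplane w.toLinearMap.isLinear _

theorem memLp_two_of_mem_densities (hD : Bornology.IsBounded D)
    {θ : EuclideanSpace ℝ (Fin N) → ℝ} (hθ : θ ∈ densities D) :
    MemLp θ 2 (volume.restrict D) := by
  have : IsFiniteMeasure (volume.restrict D) := isFiniteMeasure_restrict.2 hD.measure_lt_top.ne
  exact hθ.1.mono_exponent le_top

theorem exists_pairEquiv_ae_eq (hD : Bornology.IsBounded D)
    {θ : EuclideanSpace ℝ (Fin N) → ℝ} (hθ : θ ∈ densities D)
    {τ : EuclideanSpace ℝ (Fin N) → SymMat N} (hτ : τ ∈ admissibleStresses D ΓD ΓN g) :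
    ∃ f ∈ admissiblePairs D ΓD ΓN g,
      (fun x => pairEquiv N (f x)) =ᵐ[volume.restrict D] fun x => (θ x, τ x) := by
  -- The stress is known to be square integrable only entrywise, and the matrix units `Matrix.single
  -- i j 1` need not be symmetric. Extending the linear map to all matrices allows an expansion in
  -- these units.
  obtain ⟨G, hG⟩ := LinearMap.exists_extend
    ((pairEquiv N).symm.toLinearMap ∘ₗ LinearMap.inr ℝ ℝ (SymMat N))
  have hsplit : ∀ x, (pairEquiv N).symm (θ x, τ x) = θ x • (pairEquiv N).symm (1, 0)
      + ∑ i, ∑ j, (τ x : Matrix (Fin N) (Fin N) ℝ) i j • G (Matrix.single i j 1) := by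
    intro x
    have h1 : (pairEquiv N).symm (0, τ x) = G (τ x : Matrix (Fin N) (Fin N) ℝ) :=
      (LinearMap.congr_fun hG (τ x)).symm
    have h2 : (θ x, τ x) = θ x • ((1, 0) : ℝ × SymMat N) + (0, τ x) := by simp
    rw [h2, map_add, map_smul, h1]
    conv_lhs => rw [Matrix.matrix_eq_sum_single (τ x : Matrix (Fin N) (Fin N) ℝ)]
    simp only [map_sum, ← map_smul, Matrix.smul_single, smul_eq_mul, mul_one]
  have hsmul : ∀ {h : EuclideanSpace ℝ (Fin N) → ℝ}, MemLp h 2 (volume.restrict D) →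
      ∀ c : PairSpace N, MemLp (fun x => h x • c) 2 (volume.restrict D) := fun hh c =>
    ((ContinuousLinearMap.id ℝ ℝ).smulRight c).comp_memLp' hh
  have hmem : MemLp (fun x => (pairEquiv N).symm (θ x, τ x)) 2 (volume.restrict D) := by
    simp only [hsplit]
    refine (hsmul (memLp_two_of_mem_densities hD hθ) _).add ?_
    exact memLp_finsetSum _ fun i _ => memLp_finsetSum _ fun j _ => hsmul (hτ.memLp i j) _
  have hae : (fun x => pairEquiv N (hmem.toLp _ x)) =ᵐ[volume.restrict D]
      fun x => (θ x, τ x) := by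
    filter_upwards [hmem.coeFn_toLp] with x hx
    rw [hx, LinearEquiv.apply_symm_apply]
  refine ⟨hmem.toLp _, IsAdmissibleStress.congr_ae hτ ?_, hae⟩
  filter_upwards [hae] with x hx
  rw [hx]

/-! ### Reduction of the objective to the integral functional. -/

variable (A : HookeLaw N) (ℓ : ℝ)

/-- The shift by `|ℓ|` changes the objective by a finite constant independent of `θ` and `τ`, so
both functionals have the same minimizers. -/
theorem objective_eq_lintegral_sub (hD : Bornology.IsBounded D)
    {θ : EuclideanSpace ℝ (Fin N) → ℝ} (hθ : θ ∈ densities D)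
    (τ : EuclideanSpace ℝ (Fin N) → SymMat N) :
    objective A D ℓ θ τ = ((∫⁻ x in D, integrand A ℓ (θ x, τ x) : ℝ≥0∞) : EReal)
      - ((|ℓ| * (volume.restrict D).real univ : ℝ) : EReal) := by
  have : IsFiniteMeasure (volume.restrict D) := isFiniteMeasure_restrict.2 hD.measure_lt_top.ne
  have hθint : Integrable θ (volume.restrict D) := hθ.1.integrable le_top
  have hpos : 0 ≤ᵐ[volume.restrict D] fun x => ℓ * θ x + |ℓ| := by
    filter_upwards [hθ.2] with x hx
    simp only [Pi.zero_apply]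
    nlinarith [neg_abs_le ℓ, abs_nonneg ℓ, hx.1, hx.2]
  have hint : Integrable (fun x => ℓ * θ x + |ℓ|) (volume.restrict D) :=
    (hθint.const_mul ℓ).add (integrable_const _)
  have h1 : ∫⁻ x in D, integrand A ℓ (θ x, τ x)
      = (∫⁻ x in D, energyDensity A (θ x) (τ x))
        + ENNReal.ofReal (ℓ * (∫ x in D, θ x) + |ℓ| * (volume.restrict D).real univ) := by
    have h2 : ℓ * (∫ x in D, θ x) + |ℓ| * (volume.restrict D).real univ
        = ∫ x in D, (ℓ * θ x + |ℓ|) := by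
      rw [integral_add (hθint.const_mul ℓ) (integrable_const _), integral_const_mul,
        integral_const, smul_eq_mul, mul_comm |ℓ|]
    rw [h2, ofReal_integral_eq_lintegral_ofReal hint hpos, ← lintegral_add_right'
      _ hint.aestronglyMeasurable.aemeasurable.ennreal_ofReal]
    refine lintegral_congr_ae ?_
    filter_upwards [hθ.2] with x hx
    exact integrand_of_mem A ℓ hx
  have h3 : 0 ≤ ℓ * (∫ x in D, θ x) + |ℓ| * (volume.restrict D).real univ := by
    have := integral_nonneg_of_ae hpos
    rwa [integral_add (hθint.const_mul ℓ) (integrable_const _), integral_const_mul,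
        integral_const, smul_eq_mul, mul_comm _ |ℓ|] at this
  rw [objective, h1, EReal.coe_ennreal_add, EReal.coe_ennreal_ofReal, max_eq_left h3,
    EReal.coe_add, ← add_assoc, EReal.add_sub_cancel_right]

theorem objective_le_objective (hD : Bornology.IsBounded D)
    {θ θ' : EuclideanSpace ℝ (Fin N) → ℝ} (hθ : θ ∈ densities D) (hθ' : θ' ∈ densities D)
    {τ τ' : EuclideanSpace ℝ (Fin N) → SymMat N}
    (h : ∫⁻ x in D, integrand A ℓ (θ x, τ x) ≤ ∫⁻ x in D, integrand A ℓ (θ' x, τ' x)) :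
    objective A D ℓ θ τ ≤ objective A D ℓ θ' τ' := by
  rw [objective_eq_lintegral_sub A ℓ hD hθ, objective_eq_lintegral_sub A ℓ hD hθ']
  exact EReal.sub_le_sub (EReal.coe_ennreal_le_coe_ennreal_iff.2 h) le_rfl

theorem one_mem_densities : (fun _ => 1) ∈ densities D :=
  ⟨memLp_top_const 1, Filter.Eventually.of_forall fun _ => ⟨zero_le_one, le_rfl⟩⟩

/-- At full density the energy is a quadratic form in a square integrable stress, hence integrable.
-/
theorem lintegral_integrand_one_ne_top (hD : Bornology.IsBounded D)
    (f : Lp (PairSpace N) 2 (volume.restrict D)) :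
    ∫⁻ x in D, integrand A ℓ (1, (pairEquiv N (f x)).2) ≠ ⊤ := by
  have : IsFiniteMeasure (volume.restrict D) := isFiniteMeasure_restrict.2 hD.measure_lt_top.ne
  have hint : Integrable (fun x => A.compliance (pairEquiv N (f x)).2 (pairEquiv N (f x)).2)
      (volume.restrict D) := by
    simp only [HookeLaw.compliance_apply, contract]
    refine integrable_finsetSum _ fun i _ => integrable_finsetSum _ fun j _ => ?_
    exact (memLp_linearMap_stress f (entry i j ∘ₗ A.toEquiv.symm.toLinearMap)).integrable_mul
      (memLp_linearMap_stress f (entry i j))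
  have h : ∀ σ : SymMat N, integrand A ℓ (1, σ)
      = ENNReal.ofReal (A.compliance σ σ) + ENNReal.ofReal (ℓ + |ℓ|) := fun σ => by
    rw [integrand_of_mem A ℓ ⟨zero_le_one, le_rfl⟩, energyDensity_eq]
    simp
  simp only [h]
  rw [lintegral_add_right _ measurable_const]
  exact ENNReal.add_ne_top.2 ⟨hint.lintegral_lt_top.ne, by
    rw [lintegral_const]; exact ENNReal.mul_ne_top ENNReal.ofReal_ne_top (measure_ne_top _ _)⟩

/-- Existence of minimizers over closed convex sets of pairs. -/
theorem exists_min_lintegral_integrand (hD : Bornology.IsBounded D)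
    {K : Set (Lp (PairSpace N) 2 (volume.restrict D))} (hKclosed : IsClosed K)
    (hKconv : Convex ℝ K) (hfin : ∃ f ∈ K, ∫⁻ x in D, integrand A ℓ (pairEquiv N (f x)) ≠ ⊤) :
    ∃ f ∈ K, ∀ f' ∈ K, ∫⁻ x in D, integrand A ℓ (pairEquiv N (f x))
      ≤ ∫⁻ x in D, integrand A ℓ (pairEquiv N (f' x)) := by
  have : IsFiniteMeasure (volume.restrict D) := isFiniteMeasure_restrict.2 hD.measure_lt_top.ne
  obtain ⟨C, hC, hcoer⟩ := integrand_coercive A ℓ (pairEquiv N)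
  refine exists_isMinOn_lintegral_comp (F := fun v => integrand A ℓ (pairEquiv N v))
    ((lowerSemicontinuous_integrand A ℓ).comp
      (pairEquiv N).toLinearMap.continuous_of_finiteDimensional) (fun v w s t hs ht hst => ?_)
    hC hcoer hKclosed hKconv hfin
  rw [map_add, map_smul, map_smul]
  exact integrand_convex A ℓ _ _ s t hs ht hst

theorem density_mem_densities (hD : Bornology.IsBounded D)
    (f : Lp (PairSpace N) 2 (volume.restrict D))
    (hf : ∫⁻ x in D, integrand A ℓ (pairEquiv N (f x)) ≠ ⊤) :
    (fun x => (pairEquiv N (f x)).1) ∈ densities D := by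
  have : IsFiniteMeasure (volume.restrict D) := isFiniteMeasure_restrict.2 hD.measure_lt_top.ne
  have hmeas : AEMeasurable (fun x => integrand A ℓ (pairEquiv N (f x))) (volume.restrict D) :=
    ((lowerSemicontinuous_integrand A ℓ).comp
      (pairEquiv N).toLinearMap.continuous_of_finiteDimensional).measurable.comp_aemeasurable
      (Lp.aestronglyMeasurable f).aemeasurable
  have hmem : ∀ᵐ x ∂(volume.restrict D), (pairEquiv N (f x)).1 ∈ Icc (0 : ℝ) 1 := by
    filter_upwards [ae_lt_top' hmeas hf] with x hx
    by_contra h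
    exact hx.ne (integrand_of_notMem A ℓ h)
  refine ⟨memLp_top_of_bound (memLp_linearMap_comp f
    (LinearMap.fst ℝ ℝ (SymMat N) ∘ₗ (pairEquiv N).toLinearMap)).aestronglyMeasurable 1 ?_, hmem⟩
  filter_upwards [hmem] with x hx
  rw [Real.norm_eq_abs, abs_of_nonneg hx.1]
  exact hx.2

/-- Taking the density component is a continuous linear map between `L²` spaces, and this set is the
preimage of a point. -/
theorem isClosed_and_convex_setOf_density_eq {θ : EuclideanSpace ℝ (Fin N) → ℝ}
    (hθ : MemLp θ 2 (volume.restrict D)) :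
    IsClosed {f : Lp (PairSpace N) 2 (volume.restrict D) |
        (fun x => (pairEquiv N (f x)).1) =ᵐ[volume.restrict D] θ} ∧
      Convex ℝ {f : Lp (PairSpace N) 2 (volume.restrict D) |
        (fun x => (pairEquiv N (f x)).1) =ᵐ[volume.restrict D] θ} := by
  set P : PairSpace N →L[ℝ] ℝ := LinearMap.toContinuousLinearMap
    (LinearMap.fst ℝ ℝ (SymMat N) ∘ₗ (pairEquiv N).toLinearMap) with hP
  have h : {f : Lp (PairSpace N) 2 (volume.restrict D) |
      (fun x => (pairEquiv N (f x)).1) =ᵐ[volume.restrict D] θ}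
        = P.compLpL 2 (volume.restrict D) ⁻¹' {hθ.toLp θ} := by
    ext f
    rw [mem_preimage, mem_singleton_iff, Lp.ext_iff, mem_ofPred_eq]
    have h1 : P.compLpL 2 (volume.restrict D) f =ᵐ[volume.restrict D]
        fun x => (pairEquiv N (f x)).1 := P.coeFn_compLpL f
    exact ⟨fun h => h1.trans (h.trans hθ.coeFn_toLp.symm),
      fun h => h1.symm.trans (h.trans hθ.coeFn_toLp)⟩
  rw [h]
  exact ⟨isClosed_singleton.preimage (ContinuousLinearMap.continuous _),
    (convex_singleton _).linear_preimage (P.compLpL 2 (volume.restrict D)).toLinearMap⟩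

theorem lintegral_integrand_congr {μ : Measure (EuclideanSpace ℝ (Fin N))}
    {u v : EuclideanSpace ℝ (Fin N) → ℝ × SymMat N} (h : u =ᵐ[μ] v) :
    ∫⁻ x, integrand A ℓ (u x) ∂μ = ∫⁻ x, integrand A ℓ (v x) ∂μ :=
  lintegral_congr_ae (h.mono fun x hx => by simp only [hx])

end SIMP

/-! ### Existence for fixed density and for the joint problem. -/

theorem mainTheorem12 (N : ℕ) (hN : 2 ≤ N) (A : SIMP.HookeLaw N)
    (D ΓD ΓN : Set (EuclideanSpace ℝ (Fin N)))
    (hD_open : IsOpen D) (hD_conn : IsConnected D) (hD_bdd : Bornology.IsBounded D)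
    (hΓD : ΓD ⊆ frontier D) (hΓN : ΓN ⊆ frontier D) (hΓ : Disjoint ΓD ΓN)
    (hΓN_meas : MeasurableSet ΓN)
    (g : EuclideanSpace ℝ (Fin N) → EuclideanSpace ℝ (Fin N))
    (hg : Integrable g ((μHE[N - 1] : Measure (EuclideanSpace ℝ (Fin N))).restrict ΓN))
    (ℓ : ℝ)
    (hadm : (SIMP.admissibleStresses D ΓD ΓN g).Nonempty) :
    (∀ θ ∈ SIMP.densities D, ∃ τ ∈ SIMP.admissibleStresses D ΓD ΓN g,
      ∀ τ' ∈ SIMP.admissibleStresses D ΓD ΓN g,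
        SIMP.objective A D ℓ θ τ ≤ SIMP.objective A D ℓ θ τ') ∧
    ∃ θ ∈ SIMP.densities D, ∃ τ ∈ SIMP.admissibleStresses D ΓD ΓN g,
      SIMP.objective A D ℓ θ τ < ⊤ ∧
      ∀ θ' ∈ SIMP.densities D, ∀ τ' ∈ SIMP.admissibleStresses D ΓD ΓN g,
        SIMP.objective A D ℓ θ τ ≤ SIMP.objective A D ℓ θ' τ' := by
  obtain ⟨hclosed, hconv⟩ := SIMP.isClosed_and_convex_admissiblePairs (g := g) hD_open hD_bdd
    hΓD hΓN hΓN_meas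
  obtain ⟨τ₀, hτ₀⟩ := hadm
  constructor
  · intro θ hθ
    -- If no admissible stress has finite energy for this `θ`, all values are infinite and any
    -- admissible stress is a minimizer.
    by_cases hfin : ∃ τ ∈ SIMP.admissibleStresses D ΓD ΓN g,
        ∫⁻ x in D, SIMP.integrand A ℓ (θ x, τ x) ≠ ⊤
    · obtain ⟨hclosed', hconv'⟩ := SIMP.isClosed_and_convex_setOf_density_eq
        (SIMP.memLp_two_of_mem_densities hD_bdd hθ)
      have hlift : ∀ τ ∈ SIMP.admissibleStresses D ΓD ΓN g,
          ∃ f ∈ SIMP.admissiblePairs D ΓD ΓN g ∩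
            {f | (fun x => (SIMP.pairEquiv N (f x)).1) =ᵐ[volume.restrict D] θ},
            ∫⁻ x in D, SIMP.integrand A ℓ (SIMP.pairEquiv N (f x))
              = ∫⁻ x in D, SIMP.integrand A ℓ (θ x, τ x) := by
        intro τ hτ
        obtain ⟨f, hf, hae⟩ := SIMP.exists_pairEquiv_ae_eq hD_bdd hθ hτ
        exact ⟨f, ⟨hf, hae.fun_comp Prod.fst⟩, SIMP.lintegral_integrand_congr A ℓ hae⟩
      obtain ⟨f, ⟨hf, (hfθ : _ =ᵐ[_] _)⟩, hmin⟩ := SIMP.exists_min_lintegral_integrand A ℓ hD_bdd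
        (hclosed.inter hclosed') (hconv.inter hconv') (by
          obtain ⟨τ, hτ, h⟩ := hfin
          obtain ⟨f, hf, hfτ⟩ := hlift τ hτ
          exact ⟨f, hf, hfτ ▸ h⟩)
      refine ⟨_, hf, fun τ' hτ' => SIMP.objective_le_objective A ℓ hD_bdd hθ hθ ?_⟩
      obtain ⟨f', hf', hfτ'⟩ := hlift τ' hτ'
      -- The minimizing pair has density `θ` only almost everywhere, which suffices under the
      -- integral.
      rw [← hfτ', SIMP.lintegral_integrand_congr A ℓ (u := fun x => (θ x, _)) (v := fun x => SIMP.pairEquiv N (f x))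
        (hfθ.mono fun x hx => Prod.ext hx.symm rfl)]
      exact hmin f' hf'
    · push Not at hfin
      refine ⟨τ₀, hτ₀, fun τ' hτ' => SIMP.objective_le_objective A ℓ hD_bdd hθ hθ ?_⟩
      rw [hfin τ' hτ']
      exact le_top
  · obtain ⟨f₀, hf₀, hae₀⟩ := SIMP.exists_pairEquiv_ae_eq hD_bdd SIMP.one_mem_densities hτ₀
    have hfin₀ : ∫⁻ x in D, SIMP.integrand A ℓ (SIMP.pairEquiv N (f₀ x)) ≠ ⊤ := by
      rw [SIMP.lintegral_integrand_congr A ℓ (u := fun x => SIMP.pairEquiv N (f₀ x))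
        (v := fun x => (1, (SIMP.pairEquiv N (f₀ x)).2))
        (hae₀.mono fun x hx => Prod.ext (by rw [hx]) rfl)]
      exact SIMP.lintegral_integrand_one_ne_top A ℓ hD_bdd f₀
    obtain ⟨f, hf, hmin⟩ := SIMP.exists_min_lintegral_integrand A ℓ hD_bdd hclosed hconv
      ⟨f₀, hf₀, hfin₀⟩
    have hfin : ∫⁻ x in D, SIMP.integrand A ℓ (SIMP.pairEquiv N (f x)) ≠ ⊤ :=
      ne_top_of_le_ne_top hfin₀ (hmin f₀ hf₀)
    have hθ := SIMP.density_mem_densities A ℓ hD_bdd f hfin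
    refine ⟨_, hθ, _, hf, ?_, fun θ' hθ' τ' hτ' =>
      SIMP.objective_le_objective A ℓ hD_bdd hθ hθ' ?_⟩
    · rw [SIMP.objective_eq_lintegral_sub A ℓ hD_bdd hθ]
      rw [← EReal.coe_toReal (EReal.coe_ennreal_eq_top_iff.not.2 hfin)
        (EReal.coe_ennreal_ne_bot _), ← EReal.coe_sub]
      exact EReal.coe_lt_top _
    · obtain ⟨f', hf', hae'⟩ := SIMP.exists_pairEquiv_ae_eq hD_bdd hθ' hτ'
      rw [← SIMP.lintegral_integrand_congr A ℓ hae']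
      exact hmin f' hf'
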